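/- Let $k$ be a totally real number field with ring of integers $\mathcal O_k$, let $\Gamma=SL_2(\mathcal O_k)$, $G=PSL_2(\mathcal O_k)=\Gamma/\{\pm I\}$, and let $p:\Gamma\to G$ be the canonical projection. Let $\alpha\in\Gamma$ be an element of infinite order and let $C=\langle\alpha\rangle$ be the infinite cyclic subgroup it generates. Denote by $N_\Gamma(C)$ and $N_G(p(C))$ the normalizers of $C$ in $\Gamma$ and of $p(C)$ in $G$. Then for every integer $r\ge 0$: 1. if $N_G(p(C))\cong\mathbb Z^r$, then $N_\Gamma(C)\cong\mathbb Z^r\oplus\mathbb Z/2$; 2. if $N_G(p(C))\cong\mathbb Z^r\rtimes\mathbb Z/2$ for some action of $\mathbb Z/2$ on $\mathbb Z^r$, then $N_\Gamma(C)\cong\mathbb Z^r\rtimes\mathbb Z/4$, where the generator of $\mathbb Z/4$ acts on $\mathbb Z^r$ by multiplication by $-1$. -/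

import Mathlib

open scoped NumberField

/-- The Hilbert modular group `Γ = SL₂(𝓞 k)`. -/
abbrev HilbertModularGroup (k : Type*) [Field k] [NumberField k] : Type _ :=
  Matrix.SpecialLinearGroup (Fin 2) (𝓞 k)

/-- The reduced Hilbert modular group `G = PSL₂(𝓞 k)`, the quotient of `SL₂(𝓞 k)` by its
center, which is `{I, -I}`. -/
abbrev ReducedHilbertModularGroup (k : Type*) [Field k] [NumberField k] : Type _ :=
  Matrix.ProjectiveSpecialLinearGroup (Fin 2) (𝓞 k)

/-- The canonical projection `p : Γ → G`. -/
abbrev hilbertProj (k : Type*) [Field k] [NumberField k] :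
    HilbertModularGroup k →* ReducedHilbertModularGroup k :=
  QuotientGroup.mk' (Subgroup.center (HilbertModularGroup k))

/-! An element normalizing `p(C)` conjugates `α` to `±α` or `±α⁻¹`, and the trace, nonzero since `α`
has infinite order, excludes the minus signs. So `N_Γ(C)` is the full preimage of `N_G(p(C))`, a
central extension by `±I`.

If `xy = -yx` then `tr y = 0`, so `y² = -I` and `p(y)` is 2-torsion. Hence the preimage of a
torsion-free `ℤ^r` is commutative and `ℤ^r` lifts, which gives the first case. In the second, a lift
`t` of the involution has `t² = -I`, because `±I` are the only square roots of `I`. Were `t` to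
commute with `α`, total reality would bound all powers of `α`; so `t` inverts `α`, hence by
linearity the centralizer of `α²`, which contains the lifted `ℤ^r`. -/

/-- The homomorphism from the multiplicative cyclic group of order `n` sending the generator to an
element killed by `n`. -/
def cyclicHom {G : Type*} [Group G] (n : ℕ) (g : G) (h : g ^ n = 1) :
    Multiplicative (ZMod n) →* G :=
  AddMonoidHom.toMultiplicativeLeft
    (ZMod.lift n ⟨zmultiplesHom (Additive G) (Additive.ofMul g), by
      simp [← ofMul_pow, h]⟩)

theorem cyclicHom_gen {G : Type*} [Group G] (n : ℕ) (g : G) (h : g ^ n = 1) :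
    cyclicHom n g h (Multiplicative.ofAdd 1) = g := by
  have := ZMod.lift_coe n (⟨zmultiplesHom (Additive G) (Additive.ofMul g), by
      simp [← ofMul_pow, h]⟩ : { f : ℤ →+ Additive G // f n = 0 }) 1
  simp only [Int.cast_one] at this
  change Additive.toMul (ZMod.lift n _ 1) = g
  rw [this]
  simp

theorem exists_gen_pow {n : ℕ} [NeZero n] (x : Multiplicative (ZMod n)) :
    ∃ j : ℕ, x = (Multiplicative.ofAdd (1 : ZMod n)) ^ j := by
  refine ⟨(Multiplicative.toAdd x).val, ?_⟩
  rw [← ofAdd_nsmul]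
  simp

theorem gen_pow_eq_one {n j : ℕ} (h : n ∣ j) : (Multiplicative.ofAdd (1 : ZMod n)) ^ j = 1 := by
  rw [← ofAdd_nsmul]
  simpa using (ZMod.natCast_eq_zero_iff j n).2 h

/-- A homomorphism out of `ℤ^r` lifts along `f` as soon as the preimage of its range is
commutative and it lifts pointwise. -/
theorem exists_lift_of_commute {N H : Type*} [Group N] [Group H] {r : ℕ} (f : N →* H)
    (s : Multiplicative (Fin r → ℤ) →* H) (hs : ∀ v, ∃ x, f x = s v)
    (hc : ∀ x y, f x ∈ s.range → f y ∈ s.range → x * y = y * x) :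
    ∃ S : Multiplicative (Fin r → ℤ) →* N, ∀ v, f (S v) = s v := by
  choose L hL using hs
  let b : Fin r → N := fun i ↦ L (Multiplicative.ofAdd (Pi.single i 1))
  have hb : ∀ i, f (b i) = s (Multiplicative.ofAdd (Pi.single i 1)) := fun i ↦ hL _
  have hcomm : Pairwise fun i j ↦ ∀ x y,
      Commute (zpowersHom N (b i) x) (zpowersHom N (b j) y) := by
    intro i j _ x y
    have : Commute (b i) (b j) := hc _ _ ⟨_, (hb i).symm⟩ ⟨_, (hb j).symm⟩
    simpa using this.zpow_zpow _ _
  let E := MulEquiv.piMultiplicative (fun _ : Fin r ↦ ℤ)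
  let S' := MonoidHom.noncommPiCoprod (fun i ↦ zpowersHom N (b i)) hcomm
  have key : f.comp S' = s.comp E.symm.toMonoidHom := by
    refine MonoidHom.pi_ext fun i x ↦ ?_
    have h1 : S' (Pi.mulSingle i x) = b i ^ (Multiplicative.toAdd x) := by
      simp [S']
    have h2 : E.symm (Pi.mulSingle i x) =
        (Multiplicative.ofAdd (Pi.single i 1)) ^ (Multiplicative.toAdd x) := by
      rw [MulEquiv.symm_apply_eq, map_zpow]
      funext j
      by_cases hij : j = i
      · subst hij
        apply Multiplicative.toAdd.injective
        simp [E]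
      · apply Multiplicative.toAdd.injective
        simp [E, hij]
    simp only [MonoidHom.comp_apply, h1, map_zpow, hb, MulEquiv.toMonoidHom_eq_coe,
      MonoidHom.coe_coe, h2]
  refine ⟨S'.comp E.toMonoidHom, fun v ↦ ?_⟩
  have := DFunLike.congr_fun key (E v)
  simpa using this

theorem eq_one_of_mul_self_eq_one {r : ℕ} {v : Multiplicative (Fin r → ℤ)} (h : v * v = 1) :
    v = 1 := by
  apply Multiplicative.toAdd.injective
  have h' : Multiplicative.toAdd v + Multiplicative.toAdd v = 0 := congrArg Multiplicative.toAdd h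
  funext i
  have := congrFun h' i
  simp only [Pi.add_apply, Pi.zero_apply] at this
  simp only [toAdd_one, Pi.zero_apply]
  omega

/-! ### Central extensions by a group of order two -/

section CentralExtension

variable {N H : Type*} [Group N] [Group H] {r : ℕ} {f : N →* H} {z : N}

theorem eq_or_eq_mul_of_map_eq (hker : ∀ x, f x = 1 → x = 1 ∨ x = z) {x y : N}
    (h : f x = f y) : x = y ∨ x = z * y := by
  rcases hker (x * y⁻¹) (by simp [h]) with h | h
  · exact .inl (mul_inv_eq_one.1 h)
  · exact .inr (mul_inv_eq_iff_eq_mul.1 h)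

theorem mul_self_eq_one_of_ker (hz : f z = 1) (hker : ∀ x, f x = 1 → x = 1 ∨ x = z) :
    z * z = 1 := by
  rcases hker (z * z) (by simp [hz]) with h | h
  · exact h
  · rw [mul_eq_left] at h
    simp [h]

/-- The commutator of `x` and `y` is `1` or `z`. If it is `z`, then `f y` squares to `1` in a
torsion-free group, so `y` is `1` or `z`, hence central anyway. -/
theorem commute_of_lift_torsionFree (hz1 : z ≠ 1)
    (hzc : ∀ x, z * x = x * z) (hker : ∀ x, f x = 1 → x = 1 ∨ x = z)
    (hac : ∀ x y, x * y = z * (y * x) → y * y = z) (hz : f z = 1)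
    {s : Multiplicative (Fin r → ℤ) →* H} (hs : Function.Injective s) {x y : N}
    (hx : f x ∈ s.range) (hy : f y ∈ s.range) : x * y = y * x := by
  obtain ⟨v, hv⟩ := hx
  obtain ⟨w, hw⟩ := hy
  have hf : f (x * y) = f (y * x) := by
    rw [map_mul, map_mul, ← hv, ← hw, ← map_mul, ← map_mul, mul_comm]
  rcases eq_or_eq_mul_of_map_eq hker hf with h | h
  · exact h
  · have hyy := hac x y h
    have hw1 : w * w = 1 := by
      apply hs
      rw [map_mul, hw, ← map_mul, hyy, hz, map_one]
    have hy1 : f y = 1 := by rw [← hw, eq_one_of_mul_self_eq_one hw1, map_one]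
    rcases hker y hy1 with rfl | rfl
    · simp
    · exact (hzc x).symm

theorem nonempty_mulEquiv_prod_of_ker (hf : Function.Surjective f) (hz1 : z ≠ 1) (hz : f z = 1)
    (hzc : ∀ x, z * x = x * z) (hker : ∀ x, f x = 1 → x = 1 ∨ x = z)
    (hac : ∀ x y, x * y = z * (y * x) → y * y = z) (e : H ≃* Multiplicative (Fin r → ℤ)) :
    Nonempty (N ≃* Multiplicative ((Fin r → ℤ) × ZMod 2)) := by
  obtain ⟨S, hS⟩ := exists_lift_of_commute f e.symm.toMonoidHom (fun v ↦ hf _)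
    (fun x y ↦ commute_of_lift_torsionFree hz1 hzc hker hac hz e.symm.injective)
  replace hS : ∀ v, f (S v) = e.symm v := hS
  have hzz := mul_self_eq_one_of_ker hz hker
  have hz2 : z ^ 2 = 1 := by rw [pow_two, hzz]
  let T := cyclicHom 2 z hz2
  have hT : T (Multiplicative.ofAdd 1) = z := cyclicHom_gen 2 z hz2
  have hTj : ∀ j : ℕ, T (Multiplicative.ofAdd 1 ^ j) = z ^ j := fun j ↦ by rw [map_pow, hT]
  let F := MonoidHom.noncommCoprod S T (fun v g ↦ by
    obtain ⟨j, rfl⟩ := exists_gen_pow g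
    rw [hTj]
    exact Commute.pow_right (hzc _).symm j)
  have hF : Function.Bijective F := by
    constructor
    · rw [injective_iff_map_eq_one]
      rintro ⟨v, g⟩ h
      obtain ⟨j, rfl⟩ := exists_gen_pow g
      replace h : S v * T (Multiplicative.ofAdd 1 ^ j) = 1 := h
      rw [hTj] at h
      have hv : v = 1 := by
        have := congrArg f h
        rw [map_mul, map_pow, hz, one_pow, mul_one, hS, map_one] at this
        simpa using this
      subst hv
      rw [map_one, one_mul] at h
      have ho : orderOf z = 2 := orderOf_eq_prime hz2 hz1
      have := gen_pow_eq_one (ho ▸ orderOf_dvd_of_pow_eq_one h)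
      rw [this]
      rfl
    · intro x
      have h : f x = f (S (e (f x))) := by rw [hS]; simp
      rcases eq_or_eq_mul_of_map_eq hker h with h | h
      · refine ⟨(e (f x), 1), ?_⟩
        change S (e (f x)) * T 1 = x
        rw [map_one, mul_one, ← h]
      · refine ⟨(e (f x), Multiplicative.ofAdd 1), ?_⟩
        change S (e (f x)) * T (Multiplicative.ofAdd 1) = x
        rw [hT, ← hzc, ← h]
  exact ⟨(MulEquiv.ofBijective F hF).symm.trans (MulEquiv.prodMultiplicative _ _).symm⟩

theorem exists_mulEquiv_semidirect_of_ker (hf : Function.Surjective f) (hz1 : z ≠ 1)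
    (hz : f z = 1) (hzc : ∀ x, z * x = x * z) (hker : ∀ x, f x = 1 → x = 1 ∨ x = z)
    (hac : ∀ x y, x * y = z * (y * x) → y * y = z) (hsq : ∀ x : N, x * x = 1 → x = 1 ∨ x = z)
    (a : N) (hinv : ∀ t x, t * t = z → x * (a * a) = (a * a) * x → t * x * t⁻¹ = x⁻¹)
    (φ : Multiplicative (ZMod 2) →* MulAut (Multiplicative (Fin r → ℤ)))
    (e : H ≃* Multiplicative (Fin r → ℤ) ⋊[φ] Multiplicative (ZMod 2)) :
    ∃ ψ : Multiplicative (ZMod 4) →* MulAut (Multiplicative (Fin r → ℤ)),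
      (∀ v : Fin r → ℤ, ψ (Multiplicative.ofAdd 1) (Multiplicative.ofAdd v) =
        Multiplicative.ofAdd (-v)) ∧
      Nonempty (N ≃* Multiplicative (Fin r → ℤ) ⋊[ψ] Multiplicative (ZMod 4)) := by
  let s : Multiplicative (Fin r → ℤ) →* H := e.symm.toMonoidHom.comp SemidirectProduct.inl
  have hs : Function.Injective s := e.symm.injective.comp SemidirectProduct.inl_injective
  have hcom : ∀ x y, f x ∈ s.range → f y ∈ s.range → x * y = y * x :=
    fun x y ↦ commute_of_lift_torsionFree hz1 hzc hker hac hz hs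
  obtain ⟨S, hS⟩ := exists_lift_of_commute f s (fun v ↦ hf _) hcom
  have heS : ∀ v, e (f (S v)) = SemidirectProduct.inl v := fun v ↦ by
    rw [hS]; simp [s]
  have hzz := mul_self_eq_one_of_ker hz hker
  obtain ⟨t, ht⟩ := hf (e.symm (SemidirectProduct.inr (Multiplicative.ofAdd 1)))
  have het : e (f t) = SemidirectProduct.inr (Multiplicative.ofAdd 1) := by rw [ht]; simp
  have htt : t * t = z := by
    have h1 : f (t * t) = 1 := by
      apply e.injective
      have h2 : Multiplicative.ofAdd (1 : ZMod 2) * Multiplicative.ofAdd 1 = 1 := rfl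
      rw [map_mul, map_mul, het, ← map_mul, h2, map_one, map_one]
    rcases hker _ h1 with h | h
    · have h2 : f t = 1 := by
        rcases hsq t h with h | h
        · rw [h, map_one]
        · rw [h, hz]
      rw [h2, map_one] at het
      have := congrArg SemidirectProduct.right het
      simp only [SemidirectProduct.one_right, SemidirectProduct.right_inr] at this
      exact absurd this (by decide)
    · exact h
  have ht4 : t ^ (2 * 2) = 1 := by
    rw [pow_mul, pow_two t, htt, pow_two, hzz]
  have ho : orderOf t = 4 := by
    have : orderOf t = 2 ^ (1 + 1) := orderOf_eq_prime_pow (by rw [pow_one, pow_two, htt]; exact hz1)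
      (by simpa using ht4)
    simpa using this
  -- Squares die in `ℤ/2`. This is why the square of `a` is used: `a` itself may map outside `ℤ^r`.
  have haa : f (a * a) ∈ s.range := by
    refine ⟨(e (f (a * a))).left, ?_⟩
    apply e.injective
    simp only [s, MulEquiv.toMonoidHom_eq_coe, MonoidHom.comp_apply, MonoidHom.coe_coe,
      MulEquiv.apply_symm_apply]
    ext1
    · simp
    · rw [map_mul, map_mul, SemidirectProduct.mul_right, SemidirectProduct.right_inl]
      generalize (e (f a)).right = g
      revert g
      decide
  have hconj : ∀ v, t * S v * t⁻¹ = S v⁻¹ := fun v ↦ by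
    rw [map_inv]
    exact hinv t _ htt (hcom _ _ ⟨v, (hS v).symm⟩ haa)
  let ι : MulAut (Multiplicative (Fin r → ℤ)) := MulEquiv.inv _
  have hι : ∀ v, ι v = v⁻¹ := fun v ↦ rfl
  have hι4 : ι ^ 4 = 1 := by
    ext1 v
    simp [pow_succ, hι]
  let ψ := cyclicHom 4 ι hι4
  have hψ : ψ (Multiplicative.ofAdd 1) = ι := cyclicHom_gen 4 ι hι4
  refine ⟨ψ, fun v ↦ by rw [hψ, hι]; rfl, ?_⟩
  let T := cyclicHom 4 t ht4
  have hT : T (Multiplicative.ofAdd 1) = t := cyclicHom_gen 4 t ht4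
  have hTj : ∀ j : ℕ, T (Multiplicative.ofAdd 1 ^ j) = t ^ j := fun j ↦ by rw [map_pow, hT]
  have hact : ∀ (j : ℕ) v, S ((ι ^ j) v) = t ^ j * S v * (t ^ j)⁻¹ := by
    intro j
    induction j with
    | zero => simp
    | succ j ih =>
      intro v
      rw [pow_succ, MulAut.mul_apply, ih, hι, ← hconj, pow_succ]
      group
  let F := SemidirectProduct.lift (φ := ψ) S T (fun g ↦ by
    obtain ⟨j, rfl⟩ := exists_gen_pow g
    refine MonoidHom.ext fun v ↦ ?_
    rw [map_pow, map_pow, hψ, hT]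
    exact hact j v)
  have hF : Function.Bijective F := by
    constructor
    · rw [injective_iff_map_eq_one]
      rintro ⟨v, g⟩ h
      obtain ⟨j, rfl⟩ := exists_gen_pow g
      replace h : S v * T (Multiplicative.ofAdd 1 ^ j) = 1 := h
      rw [hTj] at h
      have hv : v = 1 := by
        have := congrArg SemidirectProduct.left (congrArg (fun x ↦ e (f x)) h)
        rw [map_mul, map_mul, heS, map_pow, map_pow, het, ← map_pow SemidirectProduct.inr] at this
        simpa [-map_pow] using this
      subst hv
      rw [map_one, one_mul] at h
      have := gen_pow_eq_one (ho ▸ orderOf_dvd_of_pow_eq_one h)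
      rw [this]
      rfl
    · intro x
      have hFm : ∀ v (j : ℕ), F ⟨v, Multiplicative.ofAdd 1 ^ j⟩ = S v * t ^ j := fun v j ↦ by
        rw [← hTj]; rfl
      obtain ⟨j, hj⟩ := exists_gen_pow (e (f x)).right
      have h : f x = f (S (e (f x)).left * t ^ j) := by
        apply e.injective
        rw [map_mul, map_mul, heS, map_pow, map_pow, het, ← map_pow, ← hj,
          SemidirectProduct.inl_left_mul_inr_right]
      rcases eq_or_eq_mul_of_map_eq hker h with h | h
      · exact ⟨_, (hFm _ j).trans h.symm⟩
      -- The shift by 2 absorbs the factor `z = t ^ 2`.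
      · refine ⟨_, (hFm (e (f x)).left (j + 2)).trans ?_⟩
        rw [pow_add, pow_two t, htt, ← mul_assoc, ← hzc, ← h]
  exact ⟨(MulEquiv.ofBijective F hF).symm⟩

end CentralExtension

/-! ### Traces, inverses and centralizers in `SL₂` -/

section SpecialLinearGroupTwo

open Matrix

variable {R : Type*} [CommRing R]

local notation "SL₂" => Matrix.SpecialLinearGroup (Fin 2)

/-- Cayley–Hamilton: it makes inversion a linear map on matrices. -/
theorem coe_inv_eq_trace_sub (x : SL₂ R) :
    (x⁻¹).1 = trace x.1 • (1 : Matrix (Fin 2) (Fin 2) R) - x.1 := by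
  rw [Matrix.SpecialLinearGroup.coe_inv, adjugate_fin_two, trace_fin_two]
  ext i j
  fin_cases i <;> fin_cases j <;> simp

theorem trace_inv_eq (x : SL₂ R) : trace (x⁻¹).1 = trace x.1 := by
  rw [Matrix.SpecialLinearGroup.coe_inv, adjugate_fin_two, trace_fin_two, trace_fin_two]
  simp [add_comm]

theorem trace_conj_eq (g x : SL₂ R) : trace (g * x * g⁻¹).1 = trace x.1 := by
  rw [Matrix.SpecialLinearGroup.coe_mul, trace_mul_comm, ← Matrix.SpecialLinearGroup.coe_mul]
  simp [-Matrix.SpecialLinearGroup.coe_mul, ← mul_assoc]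

theorem mul_self_eq_neg_one_of_trace {x : SL₂ R} (h : trace x.1 = 0) : x * x = -1 := by
  have h1 : x⁻¹ = -x := by
    apply Subtype.ext
    rw [coe_inv_eq_trace_sub, h]
    simp
  calc x * x = -(x⁻¹ * x) := by rw [h1]; simp
    _ = -1 := by simp

theorem trace_eq_zero_of_anticommute [IsDomain R] [CharZero R] {x y : SL₂ R}
    (h : x * y = -(y * x)) : trace y.1 = 0 := by
  have h1 := trace_conj_eq x y
  rw [h, neg_mul, mul_inv_cancel_right, Matrix.SpecialLinearGroup.coe_neg, trace_neg,
    neg_eq_self] at h1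
  exact h1

theorem isOfFinOrder_of_trace {x : SL₂ R} (h : trace x.1 = 0) : IsOfFinOrder x := by
  refine isOfFinOrder_iff_pow_eq_one.2 ⟨4, by norm_num, ?_⟩
  have : x ^ 4 = (x * x) * (x * x) := by simp only [pow_succ, pow_zero, one_mul, mul_assoc]
  rw [this, mul_self_eq_neg_one_of_trace h]
  simp

theorem mem_center_iff_eq_or_neg [IsDomain R] {x : SL₂ R} :
    x ∈ Subgroup.center (SL₂ R) ↔ x = 1 ∨ x = -1 := by
  rw [Matrix.SpecialLinearGroup.mem_center_iff]
  constructor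
  · rintro ⟨c, hc, h⟩
    rw [Fintype.card_fin, sq_eq_one_iff] at hc
    rcases hc with rfl | rfl
    · exact .inl (Subtype.ext (by rw [← h]; simp))
    · exact .inr (Subtype.ext (by rw [← h, map_neg, map_one]; rfl))
  · rintro (rfl | rfl)
    · exact ⟨1, by simp, by simp⟩
    · exact ⟨-1, by simp, by rw [map_neg, map_one]; rfl⟩

/-- Up to a fixed nonzero scalar, the matrices commuting with a noncentral `t` lie in `R[t]`. -/
theorem exists_smul_eq_of_commute {t : SL₂ R} (ht : t ∉ Subgroup.center (SL₂ R)) :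
    ∃ s : R, s ≠ 0 ∧ ∀ x : SL₂ R, x * t = t * x →
      ∃ u v : R, s • x.1 = u • t.1 + v • (1 : Matrix (Fin 2) (Fin 2) R) := by
  have hx : ∀ x : SL₂ R, x * t = t * x →
      t 0 1 * x 1 0 = x 0 1 * t 1 0 ∧ t 0 1 * (x 0 0 - x 1 1) = x 0 1 * (t 0 0 - t 1 1) ∧
      t 1 0 * (x 0 0 - x 1 1) = x 1 0 * (t 0 0 - t 1 1) := by
    intro x h
    have h' : x.1 * t.1 = t.1 * x.1 := congrArg Subtype.val h
    have h00 := congrFun (congrFun h' 0) 0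
    have h01 := congrFun (congrFun h' 0) 1
    have h10 := congrFun (congrFun h' 1) 0
    simp only [mul_apply, Fin.sum_univ_two] at h00 h01 h10
    refine ⟨?_, ?_, ?_⟩
    · linear_combination -h00
    · linear_combination h01
    · linear_combination -h10
  by_cases hb : t 0 1 = 0
  · by_cases hc : t 1 0 = 0
    · have hd : t 0 0 - t 1 1 ≠ 0 := by
        intro hd
        have hd' : t 0 0 = t 1 1 := sub_eq_zero.1 hd
        have hdet : t 0 0 * t 1 1 - t 0 1 * t 1 0 = 1 := by rw [← det_fin_two]; exact t.2
        apply ht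
        rw [Matrix.SpecialLinearGroup.mem_center_iff]
        refine ⟨t 0 0, ?_, ?_⟩
        · rw [Fintype.card_fin, pow_two]
          nth_rewrite 2 [hd']
          linear_combination hdet + t 0 1 * hc
        · ext i j
          fin_cases i <;> fin_cases j <;> simp [hb, hc, hd']
      refine ⟨_, hd, fun x h ↦ ⟨x 0 0 - x 1 1, t 0 0 * x 1 1 - t 1 1 * x 0 0, ?_⟩⟩
      obtain ⟨h1, h2, h3⟩ := hx x h
      ext i j
      fin_cases i <;> fin_cases j <;>
        simp only [Matrix.add_apply, Matrix.smul_apply, smul_eq_mul, Matrix.one_apply, Fin.mk_one,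
          Fin.zero_eta, if_true, Fin.isValue, one_ne_zero, zero_ne_one, if_false, mul_zero,
          mul_one, add_zero]
      · ring
      · linear_combination -h2
      · linear_combination -h3
      · ring
    · refine ⟨_, hc, fun x h ↦ ⟨x 1 0, t 1 0 * x 0 0 - x 1 0 * t 0 0, ?_⟩⟩
      obtain ⟨h1, h2, h3⟩ := hx x h
      ext i j
      fin_cases i <;> fin_cases j <;>
        simp only [Matrix.add_apply, Matrix.smul_apply, smul_eq_mul, Matrix.one_apply, Fin.mk_one,
          Fin.zero_eta, if_true, Fin.isValue, one_ne_zero, zero_ne_one, if_false, mul_zero,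
          mul_one, add_zero]
      · ring
      · linear_combination -h1
      · ring
      · linear_combination -h3
  · refine ⟨_, hb, fun x h ↦ ⟨x 0 1, t 0 1 * x 0 0 - x 0 1 * t 0 0, ?_⟩⟩
    obtain ⟨h1, h2, h3⟩ := hx x h
    ext i j
    fin_cases i <;> fin_cases j <;>
      simp only [Matrix.add_apply, Matrix.smul_apply, smul_eq_mul, Matrix.one_apply, Fin.mk_one,
        Fin.zero_eta, if_true, Fin.isValue, one_ne_zero, zero_ne_one, if_false, mul_zero,
        mul_one, add_zero]
    · ring
    · ring
    · linear_combination h1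
    · linear_combination -h2

/-- An element inverting a noncentral `a` by conjugation inverts the whole centralizer of `a`. -/
theorem conj_eq_inv_of_commute [IsDomain R] {a t x : SL₂ R} (ha : a ∉ Subgroup.center (SL₂ R))
    (hta : t * a * t⁻¹ = a⁻¹) (hx : x * a = a * x) : t * x * t⁻¹ = x⁻¹ := by
  obtain ⟨s, hs, H⟩ := exists_smul_eq_of_commute ha
  obtain ⟨u, v, h⟩ := H x hx
  have hta' : t.1 * a.1 * (t⁻¹).1 = (a⁻¹).1 := congrArg Subtype.val hta
  have htt : t.1 * (t⁻¹).1 = 1 := congrArg Subtype.val (mul_inv_cancel t)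
  apply Subtype.ext
  apply smul_right_injective _ hs
  change s • (t.1 * x.1 * (t⁻¹).1) = s • (x⁻¹).1
  -- With `s x = u a + v`, both sides become `u a⁻¹ + v`: the left by conjugation, the right by
  -- linearity of `tr - id`.
  have htr : s * trace x.1 = u * trace a.1 + 2 * v := by
    have := congrArg trace h
    simp only [trace_smul, trace_add, trace_one, Fintype.card_fin, smul_eq_mul] at this
    rw [this]
    push_cast
    ring
  rw [← smul_mul_assoc, ← mul_smul_comm, h, coe_inv_eq_trace_sub x, smul_sub, h, smul_smul, htr]
  simp only [mul_add, add_mul, mul_smul_comm, smul_mul_assoc, hta', mul_one, htt,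
    coe_inv_eq_trace_sub a, smul_sub, smul_smul]
  module

theorem eq_one_or_neg_of_mul_self [IsDomain R] [CharZero R] {x : SL₂ R} (h : x * x = 1) : x = 1 ∨ x = -1 := by
  have h1 : x⁻¹ = x := inv_eq_of_mul_eq_one_left h
  have h2 := coe_inv_eq_trace_sub x
  rw [h1] at h2
  have h00 := congrFun (congrFun h2 0) 0
  have h01 := congrFun (congrFun h2 0) 1
  have h10 := congrFun (congrFun h2 1) 0
  simp only [Matrix.sub_apply, Matrix.smul_apply, smul_eq_mul, Matrix.one_apply, trace_fin_two,
    Fin.isValue, one_ne_zero, zero_ne_one, if_false, if_true, mul_zero, mul_one, zero_sub,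
    self_eq_neg] at h00 h01 h10
  have h11 : x.1 0 0 = x.1 1 1 := by linear_combination h00
  have hdet : x.1 0 0 * x.1 1 1 - x.1 0 1 * x.1 1 0 = 1 := by rw [← det_fin_two]; exact x.2
  rw [← mem_center_iff_eq_or_neg, Matrix.SpecialLinearGroup.mem_center_iff]
  refine ⟨x.1 0 0, ?_, ?_⟩
  · rw [Fintype.card_fin, pow_two]
    nth_rewrite 2 [h11]
    linear_combination hdet + x.1 0 1 * h10
  · ext i j
    fin_cases i <;> fin_cases j <;> simp [h01, h10, ← h11]

theorem trace_eq_zero_of_mul_self {x : SL₂ R} (h : x * x = -1) : trace x.1 = 0 := by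
  have h1 : x⁻¹ = -x := inv_eq_of_mul_eq_one_left (by simp [h])
  have h2 := coe_inv_eq_trace_sub x
  rw [h1, Matrix.SpecialLinearGroup.coe_neg, eq_sub_iff_add_eq, neg_add_cancel] at h2
  have := congrFun (congrFun h2 0) 0
  simpa [trace_fin_two] using this.symm

theorem neg_one_ne_one [IsDomain R] [CharZero R] : (-1 : SL₂ R) ≠ 1 := by
  intro h
  have := congrFun (congrFun (congrArg Subtype.val h) 0) 0
  norm_num [neg_eq_self] at this

end SpecialLinearGroupTwo

/-! ### Finite order over totally real fields, and normalizers -/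

section NumberField

open Matrix NumberField

variable {k : Type*} [Field k] [NumberField k]

/-- Only finitely many algebraic integers of `k` have all conjugates bounded by `B`, so two powers
of `α` coincide. -/
theorem isOfFinOrder_of_bounded_pow (α : HilbertModularGroup k) (B : ℝ)
    (h : ∀ (n : ℕ) (i j : Fin 2) (φ : k →+* ℂ), ‖φ ((α ^ n).1 i j : k)‖ ≤ B) :
    IsOfFinOrder α := by
  have hfin := Embeddings.finite_of_norm_le k ℂ B
  have hfin' : {M : Fin 2 → Fin 2 → k |
      ∀ i j, M i j ∈ {x : k | IsIntegral ℤ x ∧ ∀ φ : k →+* ℂ, ‖φ x‖ ≤ B}}.Finite := by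
    have := Set.Finite.pi' (fun _ : Fin 2 ↦ Set.Finite.pi' (fun _ : Fin 2 ↦ hfin))
    simpa only [Set.mem_ofPred_eq] using this
  by_contra hα
  have hinj := injective_pow_iff_not_isOfFinOrder.2 hα
  refine Set.infinite_of_injective_forall_mem (f := fun (n : ℕ) (i j : Fin 2) ↦
    ((α ^ n).1 i j : k)) ?_ ?_ hfin'
  swap
  · exact fun n i j ↦ ⟨((α ^ n).1 i j).2, h n i j⟩
  intro m n hmn
  apply hinj
  ext i j
  exact congrFun (congrFun hmn i) j

/-- Over a totally real field, only elements of finite order commute with an element of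
square `-1`: the norm form `u ^ 2 + v ^ 2` bounds their entries at every real place. -/
theorem isOfFinOrder_of_commute_of_mul_self [IsTotallyReal k] {t α : HilbertModularGroup k}
    (ht : t * t = -1) (hα : α * t = t * α) : IsOfFinOrder α := by
  have htc : t ∉ Subgroup.center (HilbertModularGroup k) := by
    rw [mem_center_iff_eq_or_neg]
    have := neg_one_ne_one (R := 𝓞 k)
    rintro (rfl | rfl) <;> simp at ht <;> exact this ht.symm
  obtain ⟨s, hs, H⟩ := exists_smul_eq_of_commute htc
  have htr := trace_eq_zero_of_mul_self ht
  rw [trace_fin_two] at htr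
  have hdett : t.1 0 0 * t.1 1 1 - t.1 0 1 * t.1 1 0 = 1 := by rw [← det_fin_two]; exact t.2
  let B : ℝ := 1 + ∑ φ : k →+* ℂ, ∑ i : Fin 2, ∑ j : Fin 2, ‖φ (t.1 i j : k)‖
  refine isOfFinOrder_of_bounded_pow α B fun n i j φ ↦ ?_
  obtain ⟨u, v, huv⟩ := H (α ^ n) (Commute.pow_left hα n)
  have hij : ∀ i j, s * (α ^ n).1 i j = u * t.1 i j + v * (1 : Matrix (Fin 2) (Fin 2) (𝓞 k)) i j :=
    fun i j ↦ by simpa using congrFun (congrFun huv i) j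
  have hdet : (α ^ n).1 0 0 * (α ^ n).1 1 1 - (α ^ n).1 0 1 * (α ^ n).1 1 0 = 1 := by
    rw [← det_fin_two]; exact (α ^ n).2
  -- Take determinants in `s α ^ n = u t + v`, using `det t = 1` and `tr t = 0`.
  have hsq : s ^ 2 = u ^ 2 + v ^ 2 := by
    have h00 := hij 0 0
    have h01 := hij 0 1
    have h10 := hij 1 0
    have h11 := hij 1 1
    simp only [Matrix.one_apply, Fin.isValue, one_ne_zero, zero_ne_one, if_false, if_true,
      mul_zero, mul_one, add_zero] at h00 h01 h10 h11
    calc s ^ 2 = (s * (α ^ n).1 0 0) * (s * (α ^ n).1 1 1)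
          - (s * (α ^ n).1 0 1) * (s * (α ^ n).1 1 0) := by linear_combination (-s ^ 2) * hdet
      _ = u ^ 2 + v ^ 2 := by
        rw [h00, h01, h10, h11]
        linear_combination u ^ 2 * hdett + u * v * htr
  have hφ : ComplexEmbedding.IsReal φ := IsTotallyReal.complexEmbedding_isReal φ
  let ρ : k →+* ℝ := hφ.embedding
  have hρ : ∀ x : k, ‖φ x‖ = |ρ x| := fun x ↦ by
    rw [← hφ.coe_embedding_apply x, Complex.norm_real, Real.norm_eq_abs]
  have hs0 : 0 < |ρ (s : k)| := by
    rw [abs_pos, Ne, map_eq_zero]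
    exact_mod_cast hs
  have hsqρ : ρ (s : k) ^ 2 = ρ (u : k) ^ 2 + ρ (v : k) ^ 2 := by
    have := congrArg (fun x : 𝓞 k ↦ ρ (x : k)) hsq
    simpa using this
  have hu : |ρ (u : k)| ≤ |ρ (s : k)| := sq_le_sq.1 (by nlinarith [sq_nonneg (ρ (v : k))])
  have hv : |ρ (v : k)| ≤ |ρ (s : k)| := sq_le_sq.1 (by nlinarith [sq_nonneg (ρ (u : k))])
  have hentry := congrArg (fun x : 𝓞 k ↦ ρ (x : k)) (hij i j)
  simp only [map_mul, map_add] at hentry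
  have hone : |ρ ((1 : Matrix (Fin 2) (Fin 2) (𝓞 k)) i j : k)| ≤ 1 := by
    rw [Matrix.one_apply]
    split_ifs <;> simp
  have hB : |ρ (t.1 i j : k)| + 1 ≤ B := by
    have h1 : ‖φ (t.1 i j : k)‖ ≤ ∑ φ : k →+* ℂ, ∑ i : Fin 2, ∑ j : Fin 2, ‖φ (t.1 i j : k)‖ := by
      refine le_trans ?_ (Finset.single_le_sum (fun φ _ ↦ by positivity) (Finset.mem_univ φ))
      refine le_trans ?_ (Finset.single_le_sum (fun i _ ↦ by positivity) (Finset.mem_univ i))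
      exact Finset.single_le_sum (f := fun j ↦ ‖φ (t.1 i j : k)‖) (fun j _ ↦ by positivity)
        (Finset.mem_univ j)
    rw [hρ] at h1
    simp only [B]
    linarith
  refine le_trans ?_ hB
  rw [hρ]
  refine le_of_mul_le_mul_left ?_ hs0
  rw [← abs_mul, hentry]
  calc _ ≤ |ρ (u : k)| * |ρ (t.1 i j : k)|
        + |ρ (v : k)| * |ρ ((1 : Matrix (Fin 2) (Fin 2) (𝓞 k)) i j : k)| := by
        rw [← abs_mul, ← abs_mul]; exact abs_add_le _ _
    _ ≤ |ρ (s : k)| * |ρ (t.1 i j : k)| + |ρ (s : k)| * 1 := by gcongr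
    _ = _ := by ring

theorem hilbertProj_eq_one_iff {x : HilbertModularGroup k} :
    hilbertProj k x = 1 ↔ x = 1 ∨ x = -1 := by
  rw [← mem_center_iff_eq_or_neg, QuotientGroup.mk'_apply, QuotientGroup.eq_one_iff]

theorem hilbertProj_eq_iff {x y : HilbertModularGroup k} :
    hilbertProj k x = hilbertProj k y ↔ x = y ∨ x = -y := by
  have : hilbertProj k x = hilbertProj k y ↔ hilbertProj k (x * y⁻¹) = 1 := by
    rw [map_mul, map_inv, mul_inv_eq_one]
  rw [this, hilbertProj_eq_one_iff, mul_inv_eq_one, mul_inv_eq_iff_eq_mul, neg_one_mul]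

/-- Conjugation by an element normalizing `⟨p α⟩` sends `α` to `α` or `α⁻¹`, without sign. -/
theorem conj_eq_or_inv_of_mem_normalizer {α g : HilbertModularGroup k} (hα : ¬ IsOfFinOrder α)
    (hg : hilbertProj k g ∈ Subgroup.normalizer
      ((Subgroup.zpowers α).map (hilbertProj k) : Set (ReducedHilbertModularGroup k))) :
    g * α * g⁻¹ = α ∨ g * α * g⁻¹ = α⁻¹ := by
  have hmem : ∀ h : HilbertModularGroup k, hilbertProj k h ∈ Subgroup.normalizer
      ((Subgroup.zpowers α).map (hilbertProj k) : Set (ReducedHilbertModularGroup k)) →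
      ∃ m : ℤ, h * α * h⁻¹ = α ^ m ∨ h * α * h⁻¹ = -α ^ m := by
    intro h hh
    have hp : hilbertProj k α ∈ (Subgroup.zpowers α).map (hilbertProj k) :=
      ⟨α, Subgroup.mem_zpowers α, rfl⟩
    obtain ⟨_, ⟨m, rfl⟩, hm⟩ := (Subgroup.mem_normalizer_iff.1 hh _).1 hp
    refine ⟨m, ?_⟩
    rw [← hilbertProj_eq_iff, map_mul, map_mul, map_inv]
    exact hm.symm
  obtain ⟨m, hm⟩ := hmem g hg
  obtain ⟨n, hn⟩ := hmem g⁻¹ (by rw [map_inv]; exact inv_mem hg)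
  -- Squaring removes the sign ambiguity; conjugating by `g⁻¹` and `g` in turn then forces `m * n =
  -- 1`.
  have hsq : ∀ (h : HilbertModularGroup k) (m : ℤ),
      (h * α * h⁻¹ = α ^ m ∨ h * α * h⁻¹ = -α ^ m) → h * (α * α) * h⁻¹ = (α * α) ^ m := by
    intro h m hm
    have h1 : h * (α * α) * h⁻¹ = (h * α * h⁻¹) * (h * α * h⁻¹) := by group
    rw [h1, (Commute.refl α).mul_zpow]
    rcases hm with hm | hm <;> simp [hm]
  have hmn : m * n = 1 := by
    have h1 := hsq g m hm
    have h2 := hsq g⁻¹ n hn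
    have h3 : α * α = (α * α) ^ (n * m) := by
      rw [_root_.zpow_mul, ← h2, conj_zpow, ← h1]
      group
    have h4 : α ^ (2 : ℤ) = α ^ (2 * (n * m)) := by
      rw [_root_.zpow_mul, zpow_two]; exact h3
    have := injective_zpow_iff_not_isOfFinOrder.2 hα h4
    linarith
  have htr : trace α.1 ≠ 0 := fun h ↦ hα (isOfFinOrder_of_trace h)
  have hsign : ∀ β : HilbertModularGroup k, trace β.1 = trace α.1 → g * α * g⁻¹ ≠ -β := by
    intro β hβ h
    have := trace_conj_eq g α
    rw [h, Matrix.SpecialLinearGroup.coe_neg, trace_neg, hβ, neg_eq_self] at this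
    exact htr this
  rcases Int.eq_one_or_neg_one_of_mul_eq_one hmn with rfl | rfl
  · rw [zpow_one] at hm
    exact .inl (hm.resolve_right (hsign α rfl))
  · rw [_root_.zpow_neg_one] at hm
    exact .inr (hm.resolve_right (hsign _ (trace_inv_eq α)))

theorem comap_normalizer_map_hilbertProj {α : HilbertModularGroup k} (hα : ¬ IsOfFinOrder α) :
    (Subgroup.normalizer ((Subgroup.zpowers α).map (hilbertProj k) :
      Set (ReducedHilbertModularGroup k))).comap (hilbertProj k) =
      Subgroup.normalizer (Subgroup.zpowers α : Set (HilbertModularGroup k)) := by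
  apply le_antisymm
  · intro g hg
    rw [Subgroup.mem_normalizer_iff_map_conj_eq]
    change (Subgroup.zpowers α).map (MulAut.conj g).toMonoidHom = _
    rw [MonoidHom.map_zpowers]
    change Subgroup.zpowers (g * α * g⁻¹) = _
    rcases conj_eq_or_inv_of_mem_normalizer hα hg with h | h <;> rw [h]
    exact Subgroup.zpowers_inv
  · rw [← Subgroup.map_le_iff_le_comap]
    exact Subgroup.le_normalizer_map _

end NumberField

theorem proposition4p13 (k : Type*) [Field k] [NumberField k] [NumberField.IsTotallyReal k]
    (α : HilbertModularGroup k) (hα : ¬ IsOfFinOrder α)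
    (C : Subgroup (HilbertModularGroup k)) (hC : C = Subgroup.zpowers α) (r : ℕ) :
    -- If `N_G(p(C)) ≅ ℤ^r`, then `N_Γ(C) ≅ ℤ^r ⊕ ℤ/2`.
    (Nonempty (Subgroup.normalizer (C.map (hilbertProj k) : Set (ReducedHilbertModularGroup k)) ≃*
        Multiplicative (Fin r → ℤ)) →
      Nonempty (Subgroup.normalizer (C : Set (HilbertModularGroup k)) ≃*
        Multiplicative ((Fin r → ℤ) × ZMod 2))) ∧
    -- If `N_G(p(C)) ≅ ℤ^r ⋊ ℤ/2` for some action of `ℤ/2`, then `N_Γ(C) ≅ ℤ^r ⋊ ℤ/4`, where the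
    -- generator of `ℤ/4` acts on `ℤ^r` by multiplication by `-1`.
    ((∃ φ : Multiplicative (ZMod 2) →* MulAut (Multiplicative (Fin r → ℤ)),
        Nonempty (Subgroup.normalizer
            (C.map (hilbertProj k) : Set (ReducedHilbertModularGroup k)) ≃*
          Multiplicative (Fin r → ℤ) ⋊[φ] Multiplicative (ZMod 2))) →
      ∃ ψ : Multiplicative (ZMod 4) →* MulAut (Multiplicative (Fin r → ℤ)),
        (∀ v : Fin r → ℤ, ψ (Multiplicative.ofAdd 1) (Multiplicative.ofAdd v) =
          Multiplicative.ofAdd (-v)) ∧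
        Nonempty (Subgroup.normalizer (C : Set (HilbertModularGroup k)) ≃*
          Multiplicative (Fin r → ℤ) ⋊[ψ] Multiplicative (ZMod 4))) := by
  subst hC
  set NG := Subgroup.normalizer
    ((Subgroup.zpowers α).map (hilbertProj k) : Set (ReducedHilbertModularGroup k))
  set N := Subgroup.normalizer (Subgroup.zpowers α : Set (HilbertModularGroup k))
  have hcomap : NG.comap (hilbertProj k) = N := comap_normalizer_map_hilbertProj hα
  have hmem : ∀ x, hilbertProj k x ∈ NG ↔ x ∈ N := fun x ↦ by rw [← hcomap]; rfl
  let f : N →* NG :=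
    ((hilbertProj k).comp N.subtype).codRestrict NG fun x ↦ (hmem _).2 x.2
  have hf : Function.Surjective f := by
    rintro ⟨y, hy⟩
    obtain ⟨x, rfl⟩ := QuotientGroup.mk'_surjective _ y
    exact ⟨⟨x, (hmem x).1 hy⟩, rfl⟩
  let z : N := ⟨-1, (hmem _).1 (by rw [hilbertProj_eq_one_iff.2 (.inr rfl)]; exact one_mem _)⟩
  have hzv : (z : HilbertModularGroup k) = -1 := rfl
  have hz1 : z ≠ 1 := fun h ↦ neg_one_ne_one (R := 𝓞 k) (congrArg Subtype.val h)
  have hz : f z = 1 := Subtype.ext (hilbertProj_eq_one_iff.2 (.inr rfl))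
  have hzc : ∀ x, z * x = x * z := fun x ↦ Subtype.ext (by simp [hzv])
  have hker : ∀ x, f x = 1 → x = 1 ∨ x = z := fun x h ↦
    (hilbertProj_eq_one_iff.1 (congrArg Subtype.val h)).imp Subtype.ext Subtype.ext
  have hac : ∀ x y, x * y = z * (y * x) → y * y = z := by
    intro x y h
    have h' : (x * y : HilbertModularGroup k) = -(y * x) := by
      simpa [hzv] using congrArg Subtype.val h
    exact Subtype.ext (mul_self_eq_neg_one_of_trace (trace_eq_zero_of_anticommute h'))
  have hsq : ∀ x : N, x * x = 1 → x = 1 ∨ x = z := fun x h ↦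
    (eq_one_or_neg_of_mul_self (congrArg Subtype.val h)).imp Subtype.ext Subtype.ext
  refine ⟨fun ⟨e⟩ ↦ nonempty_mulEquiv_prod_of_ker hf hz1 hz hzc hker hac e, ?_⟩
  rintro ⟨φ, ⟨e⟩⟩
  refine exists_mulEquiv_semidirect_of_ker hf hz1 hz hzc hker hac hsq
    ⟨α, Subgroup.le_normalizer (Subgroup.mem_zpowers α)⟩ ?_ φ e
  intro t x ht hx
  replace ht : (t * t : HilbertModularGroup k) = -1 := congrArg Subtype.val ht
  replace hx : (x * (α * α) : HilbertModularGroup k) = α * α * x := congrArg Subtype.val hx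
  have hta : t.1 * α * t.1⁻¹ = α⁻¹ := by
    refine (conj_eq_or_inv_of_mem_normalizer hα ((hmem _).2 t.2)).resolve_left fun h ↦ hα ?_
    exact isOfFinOrder_of_commute_of_mul_self ht (mul_inv_eq_iff_eq_mul.1 h).symm
  -- A central square would be `±I`, making `α` of finite order.
  have hcen : α * α ∉ Subgroup.center (HilbertModularGroup k) := by
    rw [mem_center_iff_eq_or_neg]
    rintro (h | h)
    · exact hα (isOfFinOrder_iff_pow_eq_one.2 ⟨2, two_pos, by rw [pow_two, h]⟩)
    · exact hα (isOfFinOrder_of_trace (trace_eq_zero_of_mul_self h))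
  refine Subtype.ext (conj_eq_inv_of_commute hcen ?_ hx)
  rw [mul_inv_rev, ← hta]
  group
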